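/- Let $n\ge 4$ and let $W$ be the Coxeter group of type $D_n$, realised as the group of $n\times n$ monomial matrices with nonzero entries $\pm1$ whose product is $1$. A marked cycle $(x_1,\dots,x_r)$, where each $x_k$ is $p$ or $\overline p$ for some $p=|x_k|\in\{1,\dots,n\}$ and the $|x_k|$ are distinct, denotes the monomial matrix whose nonzero entry in row $|x_k|$ lies in column $|x_{k+1}|$ (cyclically) and equals $-1$ if $x_k$ is overlined and $1$ otherwise, the remaining rows being those of the identity matrix. Let $S=\{(\overline1,\overline2)\}\cup\{(k,k+1): 1\le k<n\}$ be the set of simple generators of $W$ and let $T$ be the set of all $W$-conjugates of elements of $S$, that is, the set of reflections $(i,j)$, $(\overline i,\overline j)$ with $i\ne j$. A reduced $T$-decomposition of $v\in W$ is an expression of $v$ as a product of the least possible number $\ell_T(v)$ of elements of $T$. Let $1\le m\le\lfloor n/2\rfloor$ and let $w=(m,m-1,\dots,2,\overline1)(n,n-1,\dots,\overline{m+1})$ be the $m$-th quasi-Coxeter element. Let $w_0$ be a maximal divisor of $w$ of type I, that is, $w_0=w\,(i,j)$ or $w_0=w\,(\overline i,\overline j)$ with $1\le i\le m$ and $m+1\le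 j\le n$. Then $w_0$ is a single marked cycle $(x_1,\dots,x_n)$ of length $n$ with an even number of overlined entries. For every such way of writing $w_0=(x_1,\dots,x_n)$, and for $1\le k\le n-1$, let $p=|x_k|$, $q=|x_{k+1}|$, and let $r_k=(p,q)$ if $x_k=p$ and $r_k=(\overline p,\overline q)$ if $x_k=\overline p$. Then: 1. $w_0=r_{n-1}r_{n-2}\cdots r_1$, and this is a reduced $T$-decomposition of $w_0$. 2. The decomposition diagram of $r_{n-1}\cdots r_1$ (one vertex for each factor; two vertices are joined if and only if the factors do not commute; an edge is labelled by the order of the product of the two factors if this order exceeds $3$) is the Coxeter diagram of type $A_{n-1}$, i.e. an unlabelled string with $n-1$ vertices. 3. Let $P_{w_0}=\langle r_1,\dots,r_{n-1}\rangle$. The factors of every reduced $T$-decomposition of $w_0$ generate the same subgroup $P_{w_0}$, and $w_0$ is a Coxeter element in $P_{w_0}$: there is a set $S'$ of Coxeter generators of $P_{w_0}$, whose reflections (the $P_{w_0}$-conjugates of elements of $S'$) are exactly the elements of $T\cap P_{w_0}$, such that $w_0$ is conjugate in $P_{w_0}$ to the product of the elements of $S'$ in some order. 4. $P_{w_0}$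 is a parabolic subgroup of $W$ (generated by $gIg^{-1}$ for some $I\subseteq S$, $g\in W$), and $w_0$ is a parabolic Coxeter element of $W$, i.e. for some $I\subseteq S$ and $g\in W$ it is a Coxeter element of the parabolic subgroup $\langle gIg^{-1}\rangle$ with simple generators $gIg^{-1}$. -/

import Mathlib

namespace TypeD

/-! ### Coxeter systems, reflections, reduced decompositions -/

section General

variable {G : Type*} [Group G]

/-- `(G, S)` is a Coxeter system: `G` has the Coxeter presentation with generating set `S`. -/
def IsCoxeterGeneratingSet (S : Set G) : Prop :=
  ∃ (M : CoxeterMatrix S) (cs : CoxeterSystem M G), ∀ s : S, cs.simple s = (s : G)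

/-- The reflections attached to a set `S` of simple generators: all conjugates of elements
of `S`. -/
def reflections (S : Set G) : Set G :=
  {t | ∃ s ∈ S, ∃ g : G, t = g * s * g⁻¹}

/-- The length of `w` over `T`: the least `k` such that `w` is a product of `k` elements
of `T`. -/
noncomputable def lengthOver (T : Set G) (w : G) : ℕ :=
  sInf {k | ∃ ts : List G, (∀ t ∈ ts, t ∈ T) ∧ ts.prod = w ∧ ts.length = k}

/-- `ts` is a reduced decomposition of `w` over `T`. -/
def IsReducedDecomposition (T : Set G) (ts : List G) (w : G) : Prop :=
  (∀ t ∈ ts, t ∈ T) ∧ ts.prod = w ∧ ts.length = lengthOver T w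

/-- `w` is a Coxeter element of the Coxeter system `(G, S)`: a conjugate of the product of all
simple generators, each taken once, in some order. -/
def IsCoxeterElement (S : Set G) (w : G) : Prop :=
  IsCoxeterGeneratingSet S ∧
    ∃ l : List G, l.Nodup ∧ (∀ g, g ∈ l ↔ g ∈ S) ∧ IsConj l.prod w

/-- `w` is a Coxeter element in the reflection subgroup `P` of a group with set of reflections
`T`: for some set `S'` of simple generators of `P` whose reflections are exactly the elements of
`T` lying in `P`, `w` is a Coxeter element of `(P, S')`. -/
def IsCoxeterElementIn (T : Set G) (P : Subgroup G) (w : G) : Prop :=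
  ∃ (S' : Set P) (w' : P), (w' : G) = w ∧
    (∀ t : P, t ∈ reflections S' ↔ (t : G) ∈ T) ∧ IsCoxeterElement S' w'

/-- The conjugate `g I g⁻¹` of a subset `I`. -/
def conjSet (g : G) (I : Set G) : Set G := {t | ∃ s ∈ I, t = g * s * g⁻¹}

/-- A parabolic subgroup of `(G, S)`: generated by a conjugate of a subset of `S`. -/
def IsParabolicSubgroup (S : Set G) (P : Subgroup G) : Prop :=
  ∃ I ⊆ S, ∃ g : G, P = Subgroup.closure (conjSet g I)

/-- A parabolic Coxeter element of `(G, S)`: a Coxeter element in a parabolic subgroup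
`⟨g I g⁻¹⟩`, whose set of simple generators is `g I g⁻¹`. -/
def IsParabolicCoxeterElement (S : Set G) (w : G) : Prop :=
  ∃ I ⊆ S, ∃ (g : G) (w' : Subgroup.closure (conjSet g I)), (w' : G) = w ∧
    IsCoxeterElement {s : Subgroup.closure (conjSet g I) | (s : G) ∈ conjSet g I} w'

end General

/-! ### Diagrams -/

/-- A graph some of whose edges carry a label in `ℕ` (`0` stands for `∞`). -/
structure Diagram (V : Type*) where
  graph : SimpleGraph V
  label : V → V → Option ℕ

/-- Two diagrams are equal up to a renaming of the vertices. -/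
def Diagram.IsIsomorphic {V V' : Type*} (D : Diagram V) (D' : Diagram V') : Prop :=
  ∃ e : V ≃ V', (∀ u v, D.graph.Adj u v ↔ D'.graph.Adj (e u) (e v)) ∧
    ∀ u v, D.graph.Adj u v → D.label u v = D'.label (e u) (e v)

/-- The Coxeter diagram of a Coxeter matrix: `i` and `j` are joined if `M i j ≥ 3` (or `∞`), and
the edge is labelled with `M i j` unless `M i j = 3`. -/
def coxeterDiagram {B : Type*} (M : CoxeterMatrix B) : Diagram B where
  graph := SimpleGraph.fromRel fun i j => M i j ≠ 2
  label i j := if M i j = 3 then none else some (M i j)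

/-- The decomposition diagram of `t₁ t₂ ⋯ t_k`: its vertices are the positions `1, …, k`, two
vertices are joined if the reflections do not commute, and the edge is labelled with the order of
the product when this order is greater than `3` (or infinite). -/
noncomputable def decompositionDiagram {G : Type*} [Group G] (ts : List G) :
    Diagram (Fin ts.length) where
  graph := SimpleGraph.fromRel fun i j => ¬ Commute (ts.get i) (ts.get j)
  label i j :=
    if 0 < orderOf (ts.get i * ts.get j) ∧ orderOf (ts.get i * ts.get j) ≤ 3 then none
    else some (orderOf (ts.get i * ts.get j))

/-! ### The Coxeter group of type `D_n` as a group of monomial matrices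

The indices `1, …, n` are represented by `0, …, n - 1` in `Fin n`. -/

section Monomial

variable {n : ℕ}

/-- The monomial matrix whose nonzero coefficient in row `i` is `ε i`, in column `σ i`. -/
def monomialMatrix (σ : Equiv.Perm (Fin n)) (ε : Fin n → ℤˣ) : Matrix (Fin n) (Fin n) ℤ :=
  Matrix.of fun i j => if j = σ i then (ε i : ℤ) else 0

theorem monomialMatrix_mul (σ τ : Equiv.Perm (Fin n)) (ε δ : Fin n → ℤˣ) :
    monomialMatrix σ ε * monomialMatrix τ δ =
      monomialMatrix (τ * σ) fun i => ε i * δ (σ i) := by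
  ext i j
  simp only [monomialMatrix, Matrix.mul_apply, Matrix.of_apply, Equiv.Perm.mul_apply,
    Units.val_mul]
  rw [Finset.sum_eq_single (σ i)]
  · by_cases h : j = τ (σ i) <;> simp [h]
  · intro k _ hk
    simp [hk]
  · simp

theorem monomialMatrix_one : monomialMatrix (n := n) 1 (fun _ => 1) = 1 := by
  ext i j
  simp [monomialMatrix, Matrix.one_apply, eq_comm]

/-- The monomial matrix as an invertible matrix. -/
def monomial (σ : Equiv.Perm (Fin n)) (ε : Fin n → ℤˣ) : (Matrix (Fin n) (Fin n) ℤ)ˣ where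
  val := monomialMatrix σ ε
  inv := monomialMatrix σ⁻¹ fun i => ε (σ⁻¹ i)
  val_inv := by
    rw [monomialMatrix_mul, ← monomialMatrix_one]
    congr 1
    · simp
    · funext i; simp
  inv_val := by
    rw [monomialMatrix_mul, ← monomialMatrix_one]
    congr 1
    · simp
    · funext i; simp

theorem monomial_mul (σ τ : Equiv.Perm (Fin n)) (ε δ : Fin n → ℤˣ) :
    monomial σ ε * monomial τ δ = monomial (τ * σ) fun i => ε i * δ (σ i) :=
  Units.ext (monomialMatrix_mul σ τ ε δ)

theorem monomial_inv (σ : Equiv.Perm (Fin n)) (ε : Fin n → ℤˣ) :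
    (monomial σ ε)⁻¹ = monomial σ⁻¹ fun i => ε (σ⁻¹ i) :=
  Units.ext rfl

variable (n) in
/-- The Coxeter group of type `D_n`: the monomial matrices with nonzero coefficients `±1` whose
product is `1`. -/
def W : Subgroup (Matrix (Fin n) (Fin n) ℤ)ˣ where
  carrier := {g | ∃ (σ : Equiv.Perm (Fin n)) (ε : Fin n → ℤˣ), ∏ i, ε i = 1 ∧ g = monomial σ ε}
  one_mem' := ⟨1, fun _ => 1, by simp, Units.ext monomialMatrix_one.symm⟩
  mul_mem' := by
    rintro _ _ ⟨σ, ε, hε, rfl⟩ ⟨τ, δ, hδ, rfl⟩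
    refine ⟨τ * σ, _, ?_, monomial_mul σ τ ε δ⟩
    rw [Finset.prod_mul_distrib, hε, Equiv.prod_comp σ δ, hδ, one_mul]
  inv_mem' := by
    rintro _ ⟨σ, ε, hε, rfl⟩
    exact ⟨σ⁻¹, _, by rw [Equiv.prod_comp σ⁻¹ ε, hε], monomial_inv σ ε⟩

/-- The marked cycle `(x₁, …, x_r)`. A letter `(p, 1)` stands for `p`, a letter `(p, -1)` for the
overlined `p`. Row `|x_k|` has its nonzero coefficient in column `|x_{k+1}|` (cyclically), and it
is `-1` exactly when `x_k` is overlined; the other rows are those of the identity matrix. -/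
def markedCycle (x : List (Fin n × ℤˣ)) : (Matrix (Fin n) (Fin n) ℤ)ˣ :=
  monomial (x.map Prod.fst).formPerm fun i => if (i, -1) ∈ x then -1 else 1

theorem prod_sign_pair (i j : Fin n) (s : ℤˣ) :
    ∏ k, ((if k = i then s else 1) * (if k = j then s else 1)) = 1 := by
  rw [Finset.prod_mul_distrib]
  simp

/-- For `i ≠ j`, the reflection `(i, j)` (if `s = 1`) or its overlined version (if `s = -1`). -/
def refl (i j : Fin n) (s : ℤˣ) : W n :=
  ⟨monomial (Equiv.swap i j) fun k => (if k = i then s else 1) * (if k = j then s else 1),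
    _, _, prod_sign_pair i j s, rfl⟩

theorem refl_eq_markedCycle {i j : Fin n} (h : i ≠ j) (s : ℤˣ) :
    (refl i j s : (Matrix (Fin n) (Fin n) ℤ)ˣ) = markedCycle [(i, s), (j, s)] := by
  unfold refl markedCycle
  simp only [List.map_cons, List.map_nil, List.formPerm_pair]
  congr 1
  funext k
  rcases Int.units_eq_one_or s with rfl | rfl
  · simp
  · by_cases hi : k = i
    · subst hi; simp [h]
    · by_cases hj : k = j
      · subst hj; simp [hi]
      · simp [hi, hj]

variable (n) in
/-- The simple generators of type `D_n`: the reflections `(k, k + 1)` for `1 ≤ k < n`, and the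
reflection with both entries of `(1, 2)` overlined. -/
def simpleGenerators : Set (W n) :=
  {s | (∃ i j : Fin n, (i : ℕ) + 1 = j ∧ s = refl i j 1) ∨
    ∃ i j : Fin n, (i : ℕ) = 0 ∧ (j : ℕ) = 1 ∧ s = refl i j (-1)}

variable (n) in
/-- The set `T` of reflections of `W`. -/
def T : Set (W n) := reflections (simpleGenerators n)

/-- The word `b, b - 1, …, a + 1` in the indices `1, …, n`, with its last letter `a + 1`
overlined. -/
def descendingWord (n a b : ℕ) : List (Fin n × ℤˣ) :=
  (((List.finRange n).filter fun k => a ≤ k.val ∧ k.val < b).reverse).map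
    fun k => (k, if k.val = a then -1 else 1)

/-- The quasi-Coxeter element `(m, m - 1, …, 2, 1)(n, n - 1, …, m + 1)`, where the last letters
`1` and `m + 1` of the two cycles are overlined. -/
def quasiCoxeterElement (n m : ℕ) : (Matrix (Fin n) (Fin n) ℤ)ˣ :=
  markedCycle (descendingWord n 0 m) * markedCycle (descendingWord n m n)

theorem mem_descendingWord {a b : ℕ} (hab : a < b) (i : Fin n) :
    (i, (-1 : ℤˣ)) ∈ descendingWord n a b ↔ i.val = a := by
  have h1 : (1 : ℤˣ) ≠ -1 := by decide
  simp only [descendingWord, List.mem_map, List.mem_reverse, List.mem_filter, List.mem_finRange,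
    true_and, Prod.mk.injEq, decide_eq_true_eq]
  constructor
  · rintro ⟨k, -, rfl, h⟩
    by_contra hk
    rw [if_neg hk] at h
    exact h1 h
  · intro h
    exact ⟨i, ⟨h.ge, h ▸ hab⟩, rfl, by simp [h]⟩

theorem prod_sign_descendingWord {a b : ℕ} (hab : a < b) (hbn : b ≤ n) :
    ∏ i : Fin n, (if (i, (-1 : ℤˣ)) ∈ descendingWord n a b then (-1 : ℤˣ) else 1) = -1 := by
  have h : ∀ i : Fin n, (i, (-1 : ℤˣ)) ∈ descendingWord n a b ↔ i = ⟨a, by omega⟩ := fun i => by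
    rw [mem_descendingWord hab, Fin.ext_iff]
  simp only [h, Finset.prod_ite_eq', Finset.mem_univ, if_true]

/-- The quasi-Coxeter element lies in `W`. -/
theorem quasiCoxeterElement_mem {m : ℕ} (hm : 0 < m) (hmn : m < n) :
    quasiCoxeterElement n m ∈ W n := by
  unfold quasiCoxeterElement markedCycle
  rw [monomial_mul]
  refine ⟨_, _, ?_, rfl⟩
  rw [Finset.prod_mul_distrib, prod_sign_descendingWord hm hmn.le,
    Equiv.prod_comp (List.formPerm _)
      (fun i : Fin n => if (i, (-1 : ℤˣ)) ∈ descendingWord n m n then (-1 : ℤˣ) else 1),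
    prod_sign_descendingWord hmn le_rfl]
  decide

/-- `w₀` is a maximal divisor of type I of the `m`-th quasi-Coxeter element `w`: `w₀` is the product
of `w` with the reflection `(i, j)` or with its overlined version, where `1 ≤ i ≤ m` and
`m + 1 ≤ j ≤ n`. -/
def IsTypeI (m : ℕ) (w₀ : W n) : Prop :=
  ∃ (i j : Fin n) (s : ℤˣ), (i : ℕ) < m ∧ m ≤ (j : ℕ) ∧
    (w₀ : (Matrix (Fin n) (Fin n) ℤ)ˣ) = quasiCoxeterElement n m * refl i j s

/-- `w₀` is the single marked cycle `x = (x₁, …, x_n)`, in which each of the indices `1, …, n`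
occurs exactly once, overlined or not. -/
def IsFullMarkedCycle (x : List (Fin n × ℤˣ)) (w₀ : W n) : Prop :=
  x.length = n ∧ (x.map Prod.fst).Nodup ∧
    (w₀ : (Matrix (Fin n) (Fin n) ℤ)ˣ) = markedCycle x

/-- The reflections used by the procedure for `(x₁, …, x_r)`, in the order of their use: at step
`k = 1, …, r - 1`, with `p = |x_k|` and `q = |x_{k+1}|`, it is `(p, q)` if `x_k = p`, and the
overlined version of `(p, q)` if `x_k` is the overlined `p`. (A step changes at most the mark of
the last letter `x_r`, which no step reads.) -/
def procedureReflections : List (Fin n × ℤˣ) → List (W n)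
  | [] => []
  | [_] => []
  | x :: y :: l => refl x.1 y.1 x.2 :: procedureReflections (y :: l)

end Monomial

end TypeD

open TypeD

/-! Multiplying `w` by the given reflection joins its two cycles, so the permutation underlying `w₀`
is an `n`-cycle (`exists_formPerm_eq_swap_mul`). Choose signs `d` on the indices such that `d |x_k|
* d |x_{k+1}|` is the mark of `x_k` for every `k < n`. Since the coefficients of `w₀` multiply to
`1`, the last letter then agrees too, and `w₀` is the conjugate by `diag(d)` of a permutation matrix
(`IsFullMarkedCycle.exists_signedPerm`). The same conjugation, `signedPerm d`, carries
transpositions of consecutive letters to the `r_k`. The product formula, the diagram and the Coxeter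
element property thus come from the symmetric group, whose type `A` presentation is established
through a normal form.

Reducedness and the uniqueness of the subgroup rest on a count (`card_le_and_exists_gauge`). In any
factorisation of `w₀` into reflections on pairs `{a i, b i}`, the transpositions generate a
transitive group, so the map sending `d` to the family `d (a i) * d (b i)` has only constants in its
kernel and at least `2 ^ (n - 1)` values. Hence there are at least `n - 1` factors. With exactly `n
- 1`, every choice of signs is attained, so the factors generate some `(signedPerm d').range`. As
`w₀` lies in it, `d'` equals `d` up to a global sign (`signedPerm_eq_of_mem_range`).

The subgroup is parabolic because `diag(d)`, corrected at the first index when its determinant is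
`-1`, conjugates simple generators to the generators of the range (`exists_conjSet_eq`). -/

namespace TypeD

/-! ### The symmetric group as the Coxeter group of type `A` -/

section SymmetricGroup

/-- The product `s (j + l - 1) * ⋯ * s (j + 1) * s j`. -/
def descProd {G : Type*} [Group G] (s : ℕ → G) (j : ℕ) : ℕ → G
  | 0 => 1
  | l + 1 => s (j + l) * descProd s j l

/-! ### Normal form derived from the braid relations -/

section Braid

variable {G : Type*} [Group G] {s : ℕ → G} {N : ℕ}

theorem descProd_succ' (s : ℕ → G) (j l : ℕ) :
    descProd s j (l + 1) = descProd s (j + 1) l * s j := by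
  induction l with
  | zero => simp [descProd]
  | succ l ih =>
    rw [descProd, ih, descProd, mul_assoc]
    congr 2
    omega

theorem commute_descProd {x : G} {j l : ℕ} (h : ∀ i, j ≤ i → i < j + l → Commute x (s i)) :
    Commute x (descProd s j l) := by
  induction l with
  | zero => exact Commute.one_right x
  | succ l ih =>
    exact (h _ (by omega) (by omega)).mul_right (ih fun i hi hi' => h i hi (by omega))

/-- A descending product shifts indices down by one: `s (i + 1)` commutes past the lowest factors,
meets `s (i + 1) * s i`, where the braid relation turns it into `s i`, and then commutes past the
highest factors. -/
theorem descProd_mul_simple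
    (hbr : ∀ i, i + 1 < N → s i * s (i + 1) * s i = s (i + 1) * s i * s (i + 1))
    (hcomm : ∀ i j, i + 2 ≤ j → Commute (s i) (s j)) {i j l : ℕ} (hi : j ≤ i)
    (hil : i + 1 < j + l) (hN : j + l ≤ N) :
    descProd s j l * s (i + 1) = s i * descProd s j l := by
  induction l with
  | zero => omega
  | succ l ih =>
    rcases Nat.lt_or_ge (i + 1) (j + l) with h | h
    · rw [descProd, mul_assoc, ih h (by omega), ← mul_assoc, ← mul_assoc,
        (hcomm i (j + l) (by omega)).eq]
    · obtain ⟨l, rfl⟩ : ∃ l', l = l' + 1 := ⟨l - 1, by omega⟩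
      obtain rfl : i = j + l := by omega
      have hc : Commute (s (j + l + 1)) (descProd s j l) :=
        commute_descProd fun k _ hk' => (hcomm k _ (by omega)).symm
      rw [descProd, descProd, ← Nat.add_assoc, mul_assoc, mul_assoc, ← hc.eq, ← mul_assoc,
        ← mul_assoc, ← mul_assoc, ← mul_assoc, hbr (j + l) (by omega)]

/-- The descending products ending at the top index represent the cosets of the subgroup generated
by the first `k` generators. Right multiplication by `s i` lengthens the product if `i + 1 = j`,
shortens it if `i = j`, and otherwise moves left as an earlier generator. -/
theorem exists_eq_mul_descProd (hsq : ∀ i, s i * s i = 1)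
    (hbr : ∀ i, i + 1 < N → s i * s (i + 1) * s i = s (i + 1) * s i * s (i + 1))
    (hcomm : ∀ i j, i + 2 ≤ j → Commute (s i) (s j)) {k : ℕ} (hk : k < N) {g : G}
    (hg : g ∈ Submonoid.closure (s '' Set.Iio (k + 1))) :
    ∃ h ∈ Submonoid.closure (s '' Set.Iio k), ∃ j l, j + l = k + 1 ∧ g = h * descProd s j l := by
  induction hg using Submonoid.closure_induction_right with
  | one => exact ⟨1, one_mem _, k + 1, 0, rfl, by simp [descProd]⟩
  | mul_right x _ y hy ih =>
    obtain ⟨i, hi, rfl⟩ := hy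
    obtain ⟨h, hh, j, l, hjl, rfl⟩ := ih
    have hi : i < k + 1 := hi
    rcases lt_trichotomy i j with hij | rfl | hij
    · rcases Nat.lt_or_ge (i + 1) j with h1 | h1
      · refine ⟨h * s i, mul_mem hh (Submonoid.subset_closure ⟨i, ?_, rfl⟩), j, l, hjl, ?_⟩
        · exact Set.mem_Iio.2 (by omega)
        · rw [mul_assoc, mul_assoc, Commute.eq (commute_descProd (x := s i) ?_)]
          exact fun m hm _ => hcomm i m (by omega)
      · obtain rfl : j = i + 1 := by omega
        exact ⟨h, hh, i, l + 1, by omega, by rw [descProd_succ', mul_assoc]⟩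
    · obtain ⟨l, rfl⟩ : ∃ l', l = l' + 1 := ⟨l - 1, by omega⟩
      refine ⟨h, hh, i + 1, l, by omega, ?_⟩
      rw [descProd_succ', mul_assoc, mul_assoc, hsq, mul_one]
    · obtain ⟨i, rfl⟩ : ∃ i', i = i' + 1 := ⟨i - 1, by omega⟩
      refine ⟨h * s i, mul_mem hh (Submonoid.subset_closure ⟨i, ?_, rfl⟩), j, l, hjl, ?_⟩
      · exact Set.mem_Iio.2 (by omega)
      · rw [mul_assoc, descProd_mul_simple hbr hcomm (by omega) (by omega) (by omega), mul_assoc]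

variable {X : Type*} [DecidableEq X]

/-- In the normal form `h * descProd s j l`, the second factor sends `p j` to `p (k + 1)`, which `h`
fixes. A trivial image therefore forces `j = k + 1` and `l = 0`, and induction applies to `h`. -/
theorem eq_one_of_map_eq_one (hsq : ∀ i, s i * s i = 1)
    (hbr : ∀ i, i + 1 < N → s i * s (i + 1) * s i = s (i + 1) * s i * s (i + 1))
    (hcomm : ∀ i j, i + 2 ≤ j → Commute (s i) (s j)) (f : G →* Equiv.Perm X) {p : ℕ → X}
    (hp : Set.InjOn p (Set.Iic N)) (hf : ∀ i < N, f (s i) = Equiv.swap (p i) (p (i + 1)))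
    {k : ℕ} (hk : k ≤ N) {g : G} (hg : g ∈ Submonoid.closure (s '' Set.Iio k)) (h1 : f g = 1) :
    g = 1 := by
  have hfix : ∀ k m, k < m → m ≤ N → ∀ h ∈ Submonoid.closure (s '' Set.Iio k),
      f h (p m) = p m := by
    intro k m hkm hm h hh
    induction hh using Submonoid.closure_induction with
    | mem x hx =>
      obtain ⟨i, hi, rfl⟩ := hx
      have hi : i < k := hi
      rw [hf i (by omega)]
      refine Equiv.swap_apply_of_ne_of_ne ?_ ?_ <;>
      · refine fun h => absurd (hp ?_ ?_ h) (by omega) <;> exact Set.mem_Iic.2 (by omega)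
    | one => simp
    | mul x y _ _ hx hy => rw [map_mul, Equiv.Perm.mul_apply, hy, hx]
  have hdesc : ∀ j l, j + l ≤ N → f (descProd s j l) (p j) = p (j + l) := by
    intro j l hl
    induction l with
    | zero => simp [descProd]
    | succ l ih =>
      rw [descProd, map_mul, Equiv.Perm.mul_apply, ih (by omega), hf _ (by omega),
        Equiv.swap_apply_left]
      rfl
  induction k generalizing g with
  | zero => simpa using hg
  | succ k ih =>
    obtain ⟨h, hh, j, l, hjl, rfl⟩ := exists_eq_mul_descProd hsq hbr hcomm hk hg
    have h2 : p (k + 1) = p j := by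
      have := congrArg (fun σ : Equiv.Perm X => σ (p j)) h1
      simp only [map_mul, Equiv.Perm.mul_apply, Equiv.Perm.one_apply] at this
      rwa [hdesc j l (by omega), hjl, hfix k (k + 1) (by omega) hk h hh] at this
    have h3 := hp (Set.mem_Iic.2 hk) (Set.mem_Iic.2 (by omega)) h2
    obtain rfl : l = 0 := by omega
    simp only [descProd, mul_one] at h1 ⊢
    exact ih (by omega) hh h1

end Braid

/-- The order of the product of two transpositions of consecutive points is the coefficient of the
Coxeter matrix of type `A`. -/
theorem orderOf_swap_mul_swap {X : Type*} [DecidableEq X] [Fintype X] {N : ℕ}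
    {p : Fin (N + 1) → X} (hp : Function.Injective p) (i j : Fin N) :
    orderOf (Equiv.swap (p i.castSucc) (p i.succ) * Equiv.swap (p j.castSucc) (p j.succ)) =
      CoxeterMatrix.A N i j := by
  have key : ∀ i j : Fin N, (i : ℕ) + 1 = j →
      orderOf (Equiv.swap (p i.castSucc) (p i.succ) * Equiv.swap (p j.castSucc) (p j.succ)) =
        3 := by
    intro i j h
    have h1 : j.castSucc = i.succ := Fin.ext (by simp [← h])
    rw [h1, Equiv.swap_comm]
    refine (Equiv.Perm.isThreeCycle_swap_mul_swap_same ?_ ?_ ?_).orderOf <;>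
    · refine hp.ne fun h2 => ?_
      simp only [Fin.ext_iff, Fin.val_succ, Fin.val_castSucc] at h2
      omega
  show _ = if i = j then 1 else (if (j : ℕ) + 1 = i ∨ (i : ℕ) + 1 = j then 3 else 2)
  split_ifs with h1 h2
  · rw [h1, Equiv.swap_mul_self, orderOf_one]
  · rcases h2 with h2 | h2
    · rw [← orderOf_inv, mul_inv_rev, Equiv.swap_inv, Equiv.swap_inv]
      exact key j i h2
    · exact key i j h2
  · have h3 : (i : ℕ) ≠ j := fun h => h1 (Fin.ext h)
    have hn : [p i.castSucc, p i.succ, p j.castSucc, p j.succ].Nodup := by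
      simp only [List.nodup_cons, List.mem_cons, List.not_mem_nil, or_false, hp.eq_iff,
        Fin.ext_iff, Fin.val_succ, Fin.val_castSucc, List.nodup_nil, not_false_eq_true, and_true]
      omega
    have hd : Equiv.Perm.Disjoint (Equiv.swap (p i.castSucc) (p i.succ))
        (Equiv.swap (p j.castSucc) (p j.succ)) := Equiv.Perm.disjoint_swap_swap hn
    have h4 : ∀ i : Fin N, orderOf (Equiv.swap (p i.castSucc) (p i.succ)) = 2 := fun i =>
      Equiv.Perm.IsSwap.orderOf ⟨_, _, hp.ne fun h2 => by
        simp only [Fin.ext_iff, Fin.val_succ, Fin.val_castSucc] at h2; omega, rfl⟩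
    rw [hd.orderOf, h4, h4, Nat.lcm_self]

/-- The symmetric group, generated by the transpositions of consecutive points, is the Coxeter
group of type `A`. -/
theorem exists_coxeterSystem_perm (N : ℕ) :
    ∃ cs : CoxeterSystem (CoxeterMatrix.A N) (Equiv.Perm (Fin (N + 1))),
      ∀ i, cs.simple i = Equiv.swap i.castSucc i.succ := by
  have hM : ∀ i j : Fin N, CoxeterMatrix.A N i j =
    if i = j then 1 else (if (j : ℕ) + 1 = i ∨ (i : ℕ) + 1 = j then 3 else 2) := fun _ _ => rfl
  set cs := (CoxeterMatrix.A N).toCoxeterSystem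
  have hl : (CoxeterMatrix.A N).IsLiftable fun i => Equiv.swap i.castSucc i.succ := fun i j => by
    rw [← orderOf_swap_mul_swap Function.injective_id i j]
    exact pow_orderOf_eq_one _
  set f := cs.lift ⟨_, hl⟩
  have hf : ∀ i, f (cs.simple i) = Equiv.swap i.castSucc i.succ := cs.lift_apply_simple hl
  -- With the default value `1`, the involution and commutation relations hold for all indices. The
  -- braid relation does not survive at the boundary, whence its restriction to `i + 1 < N`.
  set s : ℕ → (CoxeterMatrix.A N).Group := fun i => if h : i < N then cs.simple ⟨i, h⟩ else 1
    with hs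
  have hsi : ∀ (i : ℕ) (h : i < N), s i = cs.simple ⟨i, h⟩ := fun i h => dif_pos h
  have hsq : ∀ i, s i * s i = 1 := fun i => by
    by_cases h : i < N <;> simp [hs, h]
  have hcomm : ∀ i j, i + 2 ≤ j → Commute (s i) (s j) := by
    intro i j hij
    by_cases hj : j < N
    · have h := cs.simple_mul_simple_pow ⟨i, by omega⟩ ⟨j, hj⟩
      rw [hM, if_neg (by simp; omega), if_neg (by simp; omega), pow_two] at h
      rw [hsi i (by omega), hsi j hj, commute_iff_eq, eq_comm, ← inv_inj, mul_inv_rev,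
        cs.inv_simple, cs.inv_simple, mul_inv_rev, cs.inv_simple, cs.inv_simple]
      have h2 := eq_inv_of_mul_eq_one_left h
      rwa [mul_inv_rev, cs.inv_simple, cs.inv_simple] at h2
    · rw [show s j = 1 from dif_neg hj]
      exact Commute.one_right _
  have hbr : ∀ i, i + 1 < N → s i * s (i + 1) * s i = s (i + 1) * s i * s (i + 1) := by
    intro i hi
    have h := cs.simple_mul_simple_pow ⟨i, by omega⟩ ⟨i + 1, hi⟩
    rw [hM, if_neg (by simp), if_pos (by simp), pow_succ, pow_two] at h
    rw [hsi i (by omega), hsi _ hi]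
    have h2 := eq_inv_of_mul_eq_one_left
      (a := cs.simple ⟨i, by omega⟩ * cs.simple ⟨i + 1, hi⟩ * cs.simple ⟨i, by omega⟩)
      (b := cs.simple ⟨i + 1, hi⟩ * cs.simple ⟨i, by omega⟩ * cs.simple ⟨i + 1, hi⟩)
      (by simpa only [mul_assoc] using h)
    rw [h2, mul_inv_rev, mul_inv_rev, cs.inv_simple, cs.inv_simple, mul_assoc]
  have hinj : Function.Injective f := by
    rw [injective_iff_map_eq_one]
    intro g hg
    refine eq_one_of_map_eq_one hsq hbr hcomm f (p := fun i => Fin.ofNat (N + 1) i) ?_ ?_ le_rfl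
      ?_ hg
    · intro a ha b hb hab
      have ha : a ≤ N := ha
      have hb : b ≤ N := hb
      have := congrArg Fin.val hab
      simpa [Fin.ofNat, Nat.mod_eq_of_lt (Nat.lt_succ_of_le ha),
        Nat.mod_eq_of_lt (Nat.lt_succ_of_le hb)] using this
    · intro i hi
      rw [hsi i hi, hf]
      congr 1 <;> apply Fin.ext
      · simp [Fin.ofNat, Nat.mod_eq_of_lt (show i < N + 1 by omega)]
      · simp [Fin.ofNat, Nat.mod_eq_of_lt (show i + 1 < N + 1 by omega)]
    · have : s '' Set.Iio N = Set.range cs.simple := by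
        ext x
        constructor
        · rintro ⟨i, hi, rfl⟩
          exact ⟨⟨i, hi⟩, (hsi i hi).symm⟩
        · rintro ⟨i, rfl⟩
          exact ⟨i, i.2, hsi i i.2⟩
      rw [this, cs.submonoid_closure_range_simple]
      trivial
  have hsurj : Function.Surjective f := by
    rw [← MonoidHom.mrange_eq_top, eq_top_iff, ← Equiv.Perm.mclosure_swap_castSucc_succ,
      Submonoid.closure_le]
    rintro _ ⟨i, rfl⟩
    exact ⟨_, hf i⟩
  exact ⟨cs.map (MulEquiv.ofBijective f ⟨hinj, hsurj⟩), hf⟩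

end SymmetricGroup

section General

variable {G H : Type*} [Group G] [Group H]

theorem IsCoxeterGeneratingSet.of_coxeterSystem {B : Type*} {M : CoxeterMatrix B}
    (cs : CoxeterSystem M G) (h : Function.Injective cs.simple) :
    IsCoxeterGeneratingSet (Set.range cs.simple) := by
  refine ⟨_, cs.reindex (Equiv.ofInjective _ h), fun s => ?_⟩
  rw [cs.reindex_simple, Equiv.apply_ofInjective_symm h]

end General

/-! ### Signed symmetric groups inside `W` and the counting argument -/

section Monomial

variable {n : ℕ}

theorem monomial_injective {σ τ : Equiv.Perm (Fin n)} {ε δ : Fin n → ℤˣ}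
    (h : monomial σ ε = monomial τ δ) : σ = τ ∧ ε = δ := by
  have h0 : monomialMatrix σ ε = monomialMatrix τ δ := congrArg (fun u => u.1) h
  have h1 : ∀ i j, monomialMatrix σ ε i j = monomialMatrix τ δ i j := fun i j => by rw [h0]
  simp only [monomialMatrix, Matrix.of_apply] at h1
  have h2 : ∀ i, σ i = τ i := fun i => by
    by_contra hi
    have := h1 i (σ i)
    rw [if_pos rfl, if_neg hi] at this
    exact (ε i).ne_zero this
  refine ⟨Equiv.ext h2, funext fun i => Units.ext ?_⟩
  have := h1 i (σ i)
  rwa [if_pos rfl, if_pos (h2 i)] at this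

theorem coe_refl (i j : Fin n) (s : ℤˣ) :
    (refl i j s : (Matrix (Fin n) (Fin n) ℤ)ˣ) =
      monomial (Equiv.swap i j) fun k => (if k = i then s else 1) * (if k = j then s else 1) :=
  rfl

/-- Conjugating a reflection by a monomial matrix gives a reflection. -/
theorem conj_refl {g : W n} {σ : Equiv.Perm (Fin n)} {ε : Fin n → ℤˣ}
    (hg : (g : (Matrix (Fin n) (Fin n) ℤ)ˣ) = monomial σ⁻¹ ε) {i j : Fin n} (hij : i ≠ j)
    (s : ℤˣ) : g * refl i j s * g⁻¹ = refl (σ i) (σ j) (ε (σ i) * ε (σ j) * s) := by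
  apply Subtype.ext
  rw [Subgroup.coe_mul, Subgroup.coe_mul, Subgroup.coe_inv, hg, coe_refl, coe_refl, monomial_inv,
    monomial_mul, monomial_mul]
  congr 1
  · rw [inv_inv, Equiv.swap_apply_apply, mul_assoc]
  · funext k
    obtain ⟨k, rfl⟩ := σ.surjective k
    simp only [inv_inv, Equiv.Perm.mul_apply, Equiv.Perm.coe_inv, Equiv.symm_apply_apply, σ.injective.eq_iff]
    by_cases hi : k = i
    · subst hi
      simp [hij, mul_right_comm]
    · by_cases hj : k = j
      · subst hj
        simp [hi, mul_comm, mul_left_comm]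
      · simp [hi, hj, Equiv.swap_apply_of_ne_of_ne hi hj]

/-- The embedding of the symmetric group as the monomial matrices with coefficients `d i * d j`. -/
def signedPerm (d : Fin n → ℤˣ) : Equiv.Perm (Fin n) →* W n where
  -- The inverse is needed because `monomial` reverses products of permutations. Each value of `d`
  -- occurs twice in the product of coefficients, which is therefore `1`.
  toFun τ := ⟨monomial τ⁻¹ fun i => d i * d (τ⁻¹ i), _, _, by
    rw [Finset.prod_mul_distrib, Equiv.prod_comp τ⁻¹ d, Int.units_mul_self], rfl⟩
  map_one' := Subtype.ext <| by
    simp only [inv_one, Equiv.Perm.one_apply, Int.units_mul_self]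
    exact Units.ext monomialMatrix_one
  map_mul' σ τ := Subtype.ext <| by
    rw [Subgroup.coe_mul, monomial_mul]
    simp only [mul_inv_rev]
    congr 1
    funext i
    rw [Equiv.Perm.mul_apply, mul_assoc, ← mul_assoc (d (σ⁻¹ i)), Int.units_mul_self, one_mul]

theorem coe_signedPerm (d : Fin n → ℤˣ) (τ : Equiv.Perm (Fin n)) :
    (signedPerm d τ : (Matrix (Fin n) (Fin n) ℤ)ˣ) = monomial τ⁻¹ fun i => d i * d (τ⁻¹ i) :=
  rfl

theorem signedPerm_injective (d : Fin n → ℤˣ) : Function.Injective (signedPerm d) :=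
  fun _ _ h => inv_injective (monomial_injective (congrArg Subtype.val h)).1

theorem signedPerm_swap (d : Fin n → ℤˣ) (i j : Fin n) (h : i ≠ j) :
    signedPerm d (Equiv.swap i j) = refl i j (d i * d j) := by
  apply Subtype.ext
  rw [coe_signedPerm, coe_refl, Equiv.swap_inv]
  congr 1
  funext k
  by_cases hi : k = i
  · subst hi
    simp [h]
  · by_cases hj : k = j
    · subst hj
      simp [hi, mul_comm]
    · simp [hi, hj, Equiv.swap_apply_of_ne_of_ne hi hj]

/-- The reflections in `W` are the `(i, j)` and their overlined versions. -/
theorem mem_T_iff {t : W n} : t ∈ T n ↔ ∃ i j s, i ≠ j ∧ t = refl i j s := by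
  constructor
  · rintro ⟨s, hs, g, rfl⟩
    have hs' : ∃ i j e, i ≠ j ∧ s = refl i j e := by
      rcases hs with ⟨i, j, h, rfl⟩ | ⟨i, j, h, h', rfl⟩
      · exact ⟨i, j, 1, fun e => by subst e; omega, rfl⟩
      · exact ⟨i, j, -1, fun e => by subst e; omega, rfl⟩
    obtain ⟨i, j, e, hij, rfl⟩ := hs'
    obtain ⟨σ, ε, -, hg⟩ := g.2
    exact ⟨_, _, _, σ⁻¹.injective.ne hij, conj_refl (σ := σ⁻¹) (by rw [hg, inv_inv]) hij e⟩
  · rintro ⟨i, j, s, hij, rfl⟩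
    have hn : 2 ≤ n := by
      have : (i : ℕ) ≠ j := fun h => hij (Fin.ext h)
      omega
    set a : Fin n := ⟨0, by omega⟩
    set b : Fin n := ⟨1, by omega⟩
    have hab : a ≠ b := by simp [a, b, Fin.ext_iff]
    -- On the first two indices both reflections are simple, so it suffices to carry that pair to
    -- `(i, j)` by an unsigned permutation.
    obtain ⟨σ, rfl, rfl⟩ : ∃ σ : Equiv.Perm (Fin n), σ a = i ∧ σ b = j := by
      have hb : Equiv.swap a i b ≠ i := fun h => hab (by
        rw [← Equiv.swap_apply_left a i] at h
        exact ((Equiv.swap a i).injective h).symm)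
      refine ⟨Equiv.swap (Equiv.swap a i b) j * Equiv.swap a i, ?_, ?_⟩
      · rw [Equiv.Perm.mul_apply, Equiv.swap_apply_left,
          Equiv.swap_apply_of_ne_of_ne hb.symm hij]
      · rw [Equiv.Perm.mul_apply, Equiv.swap_apply_left]
    refine ⟨refl a b s, ?_, signedPerm (fun _ => 1) σ, ?_⟩
    · rcases Int.units_eq_one_or s with rfl | rfl
      · exact Or.inl ⟨a, b, rfl, rfl⟩
      · exact Or.inr ⟨a, b, rfl, rfl, rfl⟩
    · rw [conj_refl (coe_signedPerm _ σ) hab]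
      simp

/-- A product of reflections is a monomial matrix whose permutation lies in any subgroup containing
the permutations of the factors. -/
theorem exists_prod_eq_monomial {K : Subgroup (Equiv.Perm (Fin n))} {us : List (W n)}
    (h : ∀ u ∈ us, ∃ i j s, Equiv.swap i j ∈ K ∧ u = refl i j s) :
    ∃ ρ ∈ K, ∃ ε, (us.prod : (Matrix (Fin n) (Fin n) ℤ)ˣ) = monomial ρ ε := by
  induction us with
  | nil => exact ⟨1, one_mem _, fun _ => 1, Units.ext monomialMatrix_one.symm⟩
  | cons u us ih =>
    obtain ⟨ρ, hρ, ε, he⟩ := ih fun u hu => h u (List.mem_cons_of_mem _ hu)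
    obtain ⟨i, j, s, hK, rfl⟩ := h u List.mem_cons_self
    exact ⟨_, mul_mem hρ hK, _, by
      rw [List.prod_cons, Subgroup.coe_mul, he, coe_refl, monomial_mul]⟩

/-- If the transpositions `(a i, b i)` generate a transitive group, then signs `s i` on the pairs
`{a i, b i}` can only be independent coboundaries: there are at least `n - 1` pairs, and if there
are `n - 1` then every choice of signs is of the form `d (a i) * d (b i)`. -/
theorem card_le_and_exists_gauge {ι : Type*} [Fintype ι] (hn : 0 < n) {a b : ι → Fin n}
    (h : ∀ d : Fin n → ℤˣ, (∀ i, d (a i) = d (b i)) → ∀ p q, d p = d q) :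
    n - 1 ≤ Fintype.card ι ∧
      (Fintype.card ι = n - 1 → ∀ s : ι → ℤˣ, ∃ d : Fin n → ℤˣ, ∀ i, d (a i) * d (b i) = s i) := by
  classical
  let Φ : (Fin n → ℤˣ) →* (ι → ℤˣ) :=
    { toFun := fun d i => d (a i) * d (b i)
      map_one' := by funext i; simp
      map_mul' := fun d e => by funext i; simp [mul_mul_mul_comm] }
  -- Kernel elements are constant by `h`, hence determined by one sign.
  have hker : Nat.card Φ.ker ≤ 2 := by
    have : Function.Injective fun d : Φ.ker => (d : Fin n → ℤˣ) ⟨0, hn⟩ := by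
      intro d e hde
      apply Subtype.ext
      funext p
      have hc : ∀ d : Φ.ker, (d : Fin n → ℤˣ) p = (d : Fin n → ℤˣ) ⟨0, hn⟩ := fun d =>
        h d (fun i => by
          have h1 := congrFun (MonoidHom.mem_ker.1 d.2) i
          have h2 : (d : Fin n → ℤˣ) (a i) * (d : Fin n → ℤˣ) (b i) = 1 := h1
          rw [eq_inv_of_mul_eq_one_left h2, Int.units_inv_eq_self]) _ _
      rw [hc d, hc e]
      exact hde
    simpa using Nat.card_le_card_of_injective _ this
  have hmul := Φ.ker.card_mul_index
  rw [Subgroup.index_ker] at hmul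
  have hc : Nat.card (Fin n → ℤˣ) = 2 ^ n := by simp
  have hc' : Nat.card (ι → ℤˣ) = 2 ^ Fintype.card ι := by simp
  have h2n : 2 ^ n = 2 * 2 ^ (n - 1) := by rw [← pow_succ']; congr; omega
  have hrange : 2 ^ (n - 1) ≤ Nat.card Φ.range := by
    have := Nat.mul_le_mul_right (Nat.card Φ.range) hker
    rw [hmul, hc, h2n] at this
    omega
  have hle : Nat.card Φ.range ≤ 2 ^ Fintype.card ι := hc' ▸ Subgroup.card_le_card_group _
  refine ⟨(Nat.pow_le_pow_iff_right (by norm_num)).1 (hrange.trans hle), fun hι s => ?_⟩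
  have htop : Φ.range = ⊤ := by
    apply Subgroup.eq_top_of_le_card
    rw [hc', hι]
    exact hrange
  obtain ⟨d, hd⟩ := MonoidHom.range_eq_top.1 htop s
  exact ⟨d, fun i => congrFun hd i⟩

/-- The permutations that preserve a function. -/
def levelSubgroup (d : Fin n → ℤˣ) : Subgroup (Equiv.Perm (Fin n)) where
  carrier := {τ | ∀ k, d (τ k) = d k}
  one_mem' _ := rfl
  mul_mem' hx hy k := (hx _).trans (hy k)
  inv_mem' {x} hx k := by
    have := hx (x⁻¹ k)
    rw [Equiv.Perm.coe_inv, Equiv.apply_symm_apply] at this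
    exact this.symm

theorem eq_of_isCycleOn {ρ : Equiv.Perm (Fin n)} (hρ : ρ.IsCycleOn Set.univ) {d : Fin n → ℤˣ}
    (hd : ρ ∈ levelSubgroup d) (p q : Fin n) : d p = d q := by
  obtain ⟨i, hi⟩ := hρ.2 (Set.mem_univ p) (Set.mem_univ q)
  rw [← hi]
  exact (zpow_mem hd i p).symm

/-- The decompositions into reflections of a monomial matrix whose permutation is transitive have
at least `n - 1` factors, and those with `n - 1` factors generate a signed symmetric group. -/
theorem decomposition_of_isCycleOn {w : W n} {ρ : Equiv.Perm (Fin n)} {ε : Fin n → ℤˣ}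
    (hn : 0 < n) (hw : (w : (Matrix (Fin n) (Fin n) ℤ)ˣ) = monomial ρ ε)
    (hρ : ρ.IsCycleOn Set.univ) {us : List (W n)} (hus : ∀ u ∈ us, u ∈ T n) (hprod : us.prod = w) :
    n - 1 ≤ us.length ∧
      (us.length = n - 1 → ∃ d, Subgroup.closure {u | u ∈ us} = (signedPerm d).range) := by
  have hus' : ∀ i : Fin us.length, ∃ a b s, a ≠ b ∧ us.get i = refl a b s := fun i =>
    mem_T_iff.1 (hus _ (us.get_mem i))
  choose a b s hab hs using hus'
  have hmem : ∀ K : Subgroup (Equiv.Perm (Fin n)), (∀ i, Equiv.swap (a i) (b i) ∈ K) → ρ ∈ K := by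
    intro K hK
    obtain ⟨ρ', h1, ε', h2⟩ := exists_prod_eq_monomial (K := K) (us := us) fun u hu => by
      obtain ⟨i, rfl⟩ := List.get_of_mem hu
      exact ⟨_, _, _, hK i, hs i⟩
    rw [hprod, hw] at h2
    rwa [(monomial_injective h2).1]
  -- If every transposition preserves `d`, so does `ρ`, and `ρ` is transitive.
  have hinv : ∀ d : Fin n → ℤˣ, (∀ i, d (a i) = d (b i)) → ∀ p q, d p = d q := by
    intro d hd
    refine eq_of_isCycleOn hρ (hmem (levelSubgroup d) fun i k => ?_)
    rw [Equiv.swap_apply_def]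
    split_ifs with h1 h2
    · rw [h1, hd]
    · rw [h2, hd]
    · rfl
  obtain ⟨h1, h2⟩ := card_le_and_exists_gauge hn hinv
  rw [Fintype.card_fin] at h1 h2
  refine ⟨h1, fun h => ?_⟩
  obtain ⟨d, hd⟩ := h2 h s
  refine ⟨d, ?_⟩
  have hS : {u | u ∈ us} = signedPerm d '' Set.range fun i => Equiv.swap (a i) (b i) := by
    ext u
    constructor
    · intro hu
      obtain ⟨i, rfl⟩ := List.get_of_mem hu
      exact ⟨_, ⟨i, rfl⟩, by rw [signedPerm_swap d _ _ (hab i), hd, hs]⟩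
    · rintro ⟨_, ⟨i, rfl⟩, rfl⟩
      rw [signedPerm_swap d _ _ (hab i), hd, ← hs]
      exact us.get_mem i
  have hρmem : ρ ∈ Subgroup.closure (Set.range fun i => Equiv.swap (a i) (b i)) :=
    hmem _ fun i => Subgroup.subset_closure ⟨i, rfl⟩
  -- A transitive group generated by transpositions is the full symmetric group.
  have : MulAction.IsPretransitive
      (Subgroup.closure (Set.range fun i => Equiv.swap (a i) (b i))) (Fin n) := ⟨fun p q => by
    obtain ⟨i, hi⟩ := hρ.2 (Set.mem_univ p) (Set.mem_univ q)
    exact ⟨⟨ρ ^ i, zpow_mem hρmem i⟩, hi⟩⟩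
  rw [hS, ← MonoidHom.map_closure, closure_of_isSwap_of_isPretransitive, ← MonoidHom.range_eq_map]
  rintro _ ⟨i, rfl⟩
  exact ⟨_, _, hab i, rfl⟩

end Monomial

/-! ### Joining two cycles by a transposition -/

section Cycles

theorem formPerm_append_singleton_mul {α : Type*} [DecidableEq α] (l₁ l₂ : List α) (i : α) :
    (l₁ ++ [i]).formPerm * (i :: l₂).formPerm = (l₁ ++ i :: l₂).formPerm := by
  induction l₁ with
  | nil => simp
  | cons a l₁ ih =>
    cases l₁ with
    | nil => simp
    | cons b l₁ =>
      simp only [List.cons_append, List.formPerm_cons_cons, mul_assoc] at ih ⊢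
      rw [ih]

theorem exists_isRotated_cons {α : Type*} {l : List α} {i : α} (hi : i ∈ l) :
    ∃ l', l.IsRotated (i :: l') := by
  obtain ⟨u, v, rfl⟩ := List.append_of_mem hi
  exact ⟨v ++ u, by simpa using List.isRotated_append (l := u) (l' := i :: v)⟩

/-- A transposition joins two disjoint cycles. -/
theorem exists_formPerm_eq_swap_mul {α : Type*} [DecidableEq α] {l₁ l₂ : List α}
    (h : (l₁ ++ l₂).Nodup) {i j : α} (hi : i ∈ l₁) (hj : j ∈ l₂) :
    ∃ y : List α, y.Perm (l₁ ++ l₂) ∧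
      Equiv.swap i j * (l₂.formPerm * l₁.formPerm) = y.formPerm := by
  obtain ⟨h₁, h₂, hd⟩ := List.nodup_append.1 h
  obtain ⟨u, hu⟩ := exists_isRotated_cons hi
  obtain ⟨v, hv⟩ := exists_isRotated_cons hj
  -- Rotate the cycles to start at `i` and `j`. The transposition extends `(j, v)` to `(i, j, v)`,
  -- which rotates to `(j, v, i)` and can be glued to `(i, u)` at the common letter.
  refine ⟨j :: v ++ i :: u, (List.perm_append_comm).trans (hu.perm.symm.append hv.perm.symm), ?_⟩
  have hiv : (i :: j :: v).Nodup := List.nodup_cons.2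
    ⟨fun hm => hd i hi i (hv.perm.mem_iff.2 hm) rfl, hv.perm.nodup_iff.1 h₂⟩
  rw [List.formPerm_eq_of_isRotated h₁ hu, List.formPerm_eq_of_isRotated h₂ hv, ← mul_assoc,
    ← List.formPerm_cons_cons, ← formPerm_append_singleton_mul]
  congr 1
  refine List.formPerm_eq_of_isRotated hiv ?_
  simpa using List.isRotated_append (l := [i]) (l' := j :: v)

end Cycles

/-! ### Divisors of type I are full marked cycles -/

section TypeI

variable {n : ℕ}

theorem toFinset_eq_univ {y : List (Fin n)} (hy : y.Nodup) (hl : y.length = n) :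
    y.toFinset = Finset.univ := by
  apply Finset.eq_univ_of_card
  rw [List.toFinset_card_of_nodup hy, hl, Fintype.card_fin]

theorem mem_of_nodup_of_length {y : List (Fin n)} (hy : y.Nodup) (hl : y.length = n) (i : Fin n) :
    i ∈ y :=
  List.mem_toFinset.1 (toFinset_eq_univ hy hl ▸ Finset.mem_univ i)

theorem prod_eq_neg_one_pow_countP (x : List (Fin n × ℤˣ)) :
    (x.map Prod.snd).prod = (-1) ^ (x.countP fun y => y.2 = -1) := by
  induction x with
  | nil => simp
  | cons a x ih =>
    rw [List.map_cons, List.prod_cons, ih, List.countP_cons]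
    rcases Int.units_eq_one_or a.2 with h | h
    · simp [h, show (1 : ℤˣ) ≠ -1 by decide]
    · simp [h, pow_succ]

/-- A monomial matrix in `W` whose permutation is an `n`-cycle is a marked cycle with an even
number of overlined letters. -/
theorem exists_isFullMarkedCycle {w : W n} {y : List (Fin n)} (hy : y.Nodup) (hl : y.length = n)
    {ε : Fin n → ℤˣ} (hw : (w : (Matrix (Fin n) (Fin n) ℤ)ˣ) = monomial y.formPerm ε) :
    ∃ x, IsFullMarkedCycle x w ∧ Even (x.countP fun y => y.2 = -1) := by
  refine ⟨y.map fun k => (k, ε k), ⟨by simpa using hl, ?_, ?_⟩, ?_⟩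
  · simpa [Function.comp_def] using hy
  · rw [hw, markedCycle]
    congr 1
    · simp [Function.comp_def]
    · funext i
      have hi := mem_of_nodup_of_length hy hl i
      rcases Int.units_eq_one_or (ε i) with h | h
      · simp [h, show (1 : ℤˣ) ≠ -1 by decide]
      · simp [h, hi]
  · obtain ⟨σ, δ, hδ, hw'⟩ := w.2
    rw [hw] at hw'
    rw [← (monomial_injective hw').2] at hδ
    have h : ((y.map fun k => (k, ε k)).map Prod.snd).prod = 1 := by
      rw [← hδ, List.map_map, ← toFinset_eq_univ hy hl, List.prod_toFinset _ hy]
      rfl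
    rw [prod_eq_neg_one_pow_countP] at h
    by_contra hodd
    rw [(Nat.not_even_iff_odd.1 hodd).neg_one_pow] at h
    exact absurd h (by decide)

theorem map_fst_descendingWord (n a b : ℕ) : (descendingWord n a b).map Prod.fst =
    ((List.finRange n).filter fun k => a ≤ k.val ∧ k.val < b).reverse := by
  simp [descendingWord, Function.comp_def]

theorem IsTypeI.exists_isFullMarkedCycle {m : ℕ} {w₀ : W n} (h : IsTypeI m w₀) :
    ∃ x, IsFullMarkedCycle x w₀ ∧ Even (x.countP fun y => y.2 = -1) := by
  obtain ⟨i, j, s, hi, hj, hw⟩ := h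
  have hnd : ((descendingWord n 0 m).map Prod.fst ++ (descendingWord n m n).map Prod.fst).Nodup := by
    simp only [map_fst_descendingWord]
    refine List.nodup_append.2 ⟨?_, ?_, ?_⟩
    · exact List.nodup_reverse.2 ((List.nodup_finRange n).filter _)
    · exact List.nodup_reverse.2 ((List.nodup_finRange n).filter _)
    · intro a ha b hb hab
      simp at ha hb
      omega
  have hmem : ∀ k, k ∈
      (descendingWord n 0 m).map Prod.fst ++ (descendingWord n m n).map Prod.fst := fun k => by
    simp only [map_fst_descendingWord]
    simp
    omega
  obtain ⟨y, hy, hs⟩ := exists_formPerm_eq_swap_mul hnd (i := i) (j := j)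
    (by simpa [map_fst_descendingWord] using hi) (by simpa [map_fst_descendingWord] using hj)
  rw [quasiCoxeterElement, markedCycle, markedCycle, coe_refl, monomial_mul, monomial_mul, hs] at hw
  have hy' : y.Nodup := hy.nodup_iff.2 hnd
  refine TypeD.exists_isFullMarkedCycle hy' ?_ hw
  rw [← List.toFinset_card_of_nodup hy', Finset.eq_univ_of_forall (s := y.toFinset) fun k =>
    List.mem_toFinset.2 (hy.mem_iff.2 (hmem k)), Finset.card_univ, Fintype.card_fin]

end TypeI

/-! ### Choosing signs along a marked cycle -/

section Procedure

variable {n : ℕ}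

theorem length_procedureReflections : ∀ x : List (Fin n × ℤˣ),
    (procedureReflections x).length = x.length - 1
  | [] => rfl
  | [_] => rfl
  | x :: y :: l => by
    rw [procedureReflections, List.length_cons, length_procedureReflections (y :: l)]
    simp

theorem procedureReflections_eq_map {d : Fin n → ℤˣ} : ∀ {x : List (Fin n × ℤˣ)},
    (x.map Prod.fst).Nodup → x.IsChain (fun u v => d u.1 * d v.1 = u.2) →
    procedureReflections x =
      (List.zipWith Equiv.swap (x.map Prod.fst) (x.map Prod.fst).tail).map (signedPerm d)
  | [], _, _ => rfl
  | [_], _, _ => rfl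
  | x :: y :: l, hn, hc => by
    obtain ⟨h1, h2⟩ := List.isChain_cons_cons.1 hc
    have h3 : x.1 ≠ y.1 := fun h => by simp [h] at hn
    rw [procedureReflections, procedureReflections_eq_map (List.nodup_cons.1 hn).2 h2, ← h1,
      ← signedPerm_swap d _ _ h3]
    rfl

/-- The constraints run along a path, so they can be solved from the last letter backwards: each new
index is fresh, and its sign is dictated by that of its successor. The mark of the last letter is
not constrained. -/
theorem exists_gauge {x : List (Fin n × ℤˣ)} (hx : (x.map Prod.fst).Nodup) :
    ∃ d : Fin n → ℤˣ, x.IsChain fun u v => d u.1 * d v.1 = u.2 := by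
  induction x with
  | nil => exact ⟨1, List.IsChain.nil⟩
  | cons u x ih =>
    obtain ⟨hu, hx⟩ := List.nodup_cons.1 hx
    obtain ⟨d, hd⟩ := ih hx
    cases x with
    | nil => exact ⟨1, List.IsChain.singleton _⟩
    | cons v l =>
      have hne : ∀ a ∈ v :: l, a.1 ≠ u.1 := fun a ha h =>
        hu (h ▸ List.mem_map_of_mem ha)
      refine ⟨Function.update d u.1 (u.2 * d v.1), List.isChain_cons_cons.2 ⟨?_, ?_⟩⟩
      · rw [Function.update_self, Function.update_of_ne (hne v List.mem_cons_self), mul_assoc,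
          Int.units_mul_self, mul_one]
      · rw [List.isChain_iff_getElem] at hd ⊢
        intro i hi
        rw [Function.update_of_ne (hne _ (List.getElem_mem _)),
          Function.update_of_ne (hne _ (List.getElem_mem _))]
        exact hd i hi

theorem eq_of_prod_eq {f g : Fin n → ℤˣ} (h : ∏ i, f i = ∏ i, g i) (a : Fin n)
    (ha : ∀ i, i ≠ a → f i = g i) : f = g := by
  funext i
  by_cases hi : i = a
  · subst hi
    rw [← Finset.mul_prod_erase _ f (Finset.mem_univ i),
      ← Finset.mul_prod_erase _ g (Finset.mem_univ i),
      Finset.prod_congr rfl fun j hj => ha j (Finset.ne_of_mem_erase hj)] at h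
    exact mul_right_cancel h
  · exact ha i hi

/-- The signs from `exists_gauge` give the right coefficient at every letter but the last. Both
families of coefficients have product `1`, which settles the remaining one. -/
theorem IsFullMarkedCycle.exists_signedPerm (hn : 0 < n) {x : List (Fin n × ℤˣ)} {w : W n}
    (h : IsFullMarkedCycle x w) :
    ∃ d : Fin n → ℤˣ, (x.IsChain fun u v => d u.1 * d v.1 = u.2) ∧
      w = signedPerm d (x.map Prod.fst).formPerm⁻¹ := by
  obtain ⟨hl, hnd, hw⟩ := h
  obtain ⟨d, hd⟩ := exists_gauge hnd
  refine ⟨d, hd, Subtype.ext ?_⟩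
  rw [hw, coe_signedPerm, inv_inv, markedCycle]
  congr 1
  obtain ⟨σ, δ, hδ, hw'⟩ := w.2
  rw [hw, markedCycle] at hw'
  rw [← (monomial_injective hw').2] at hδ
  refine eq_of_prod_eq ?_ (x[n - 1]'(by omega)).1 fun i hi => ?_
  · rw [hδ, Finset.prod_mul_distrib, Equiv.prod_comp _ d, Int.units_mul_self]
  · obtain ⟨k, hk, rfl⟩ := List.getElem_of_mem
      (mem_of_nodup_of_length hnd (by simpa using hl) i)
    have hk' : k < x.length := by simpa using hk
    have hk1 : k + 1 < x.length := by
      by_contra hlt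
      obtain rfl : k = n - 1 := by omega
      simp at hi
    have hf := List.formPerm_apply_lt_getElem _ hnd k (by simpa using hk1)
    rw [hf]
    have hc := List.isChain_iff_getElem.1 hd k hk1
    simp only [List.getElem_map]
    rw [hc]
    have hinj : ∀ s, (x[k].1, s) ∈ x → s = x[k].2 := fun s hs => by
      have := List.inj_on_of_nodup_map hnd hs (List.getElem_mem hk') rfl
      rw [← this]
    by_cases hm : (x[k].1, (-1 : ℤˣ)) ∈ x
    · rw [if_pos hm, hinj _ hm]
    · rw [if_neg hm]
      rcases Int.units_eq_one_or x[k].2 with h | h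
      · exact h.symm
      · exact absurd (by rw [← h]; exact List.getElem_mem hk') hm

/-- Membership of `w` forces `d i * d (ρ i) = ε i`, so `d * d'` is invariant under the transitive
`ρ`, hence constant. A global sign cancels in `signedPerm`. -/
theorem signedPerm_eq_of_mem_range {w : W n} {ρ : Equiv.Perm (Fin n)} {ε : Fin n → ℤˣ}
    (hw : (w : (Matrix (Fin n) (Fin n) ℤ)ˣ) = monomial ρ ε) (hρ : ρ.IsCycleOn Set.univ)
    {d d' : Fin n → ℤˣ} (h : w ∈ (signedPerm d).range) (h' : w ∈ (signedPerm d').range) :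
    signedPerm d = signedPerm d' := by
  have key : ∀ d : Fin n → ℤˣ, w ∈ (signedPerm d).range → ∀ i, d i * d (ρ i) = ε i := by
    rintro d ⟨τ, rfl⟩ i
    rw [coe_signedPerm] at hw
    obtain ⟨rfl, rfl⟩ := monomial_injective hw
    rfl
  have h1 : ∀ i j, d i * d' i = d j * d' j := eq_of_isCycleOn (d := fun i => d i * d' i) hρ
    fun i => by
      have h2 : (d i * d' i) * (d (ρ i) * d' (ρ i)) = 1 := by
        rw [mul_mul_mul_comm, key d h, key d' h', Int.units_mul_self]
      show d (ρ i) * d' (ρ i) = d i * d' i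
      rw [eq_inv_of_mul_eq_one_left h2, Int.units_inv_eq_self]
  ext1 τ
  apply Subtype.ext
  rw [coe_signedPerm, coe_signedPerm]
  congr 1
  funext i
  have h3 : (d i * d (τ⁻¹ i)) * (d' i * d' (τ⁻¹ i)) = 1 := by
    rw [mul_mul_mul_comm, h1 i (τ⁻¹ i), Int.units_mul_self]
  rw [eq_inv_of_mul_eq_one_left h3, Int.units_inv_eq_self]

end Procedure

/-! ### Recognising the diagram of type `A` -/

section Diagram

variable {G : Type*} [Group G]

/-- The decomposition diagram of a string of elements whose products have the orders given by the
Coxeter matrix of type `A` is the Coxeter diagram of type `A`. -/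
theorem decompositionDiagram_isIsomorphic {N : ℕ} {ts : List G} (hl : ts.length = N)
    (h : ∀ i j, orderOf (ts.get i * ts.get j) =
      CoxeterMatrix.A N (finCongr hl i) (finCongr hl j)) :
    (decompositionDiagram ts).IsIsomorphic (coxeterDiagram (CoxeterMatrix.A N)) := by
  have hM : ∀ i j : Fin N, CoxeterMatrix.A N i j =
    if i = j then 1 else (if (j : ℕ) + 1 = i ∨ (i : ℕ) + 1 = j then 3 else 2) := fun _ _ => rfl
  have hsq : ∀ i, ts.get i * ts.get i = 1 := fun i => by
    rw [← orderOf_eq_one_iff, h, CoxeterMatrix.diagonal]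
  have hinv : ∀ i, (ts.get i)⁻¹ = ts.get i := fun i => inv_eq_of_mul_eq_one_left (hsq i)
  have hcomm : ∀ i j, i ≠ j → (Commute (ts.get i) (ts.get j) ↔
      CoxeterMatrix.A N (finCongr hl i) (finCongr hl j) = 2) := by
    intro i j hij
    have hij' : finCongr hl i ≠ finCongr hl j := (finCongr hl).injective.ne hij
    -- Two involutions commute exactly when the order of their product divides `2`; off the diagonal
    -- the order is `2` or `3`.
    have h1 : Commute (ts.get i) (ts.get j) ↔ (ts.get i * ts.get j) ^ 2 = 1 := by
      rw [pow_two, mul_eq_one_iff_eq_inv, mul_inv_rev, hinv, hinv]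
      rfl
    rw [h1, ← orderOf_dvd_iff_pow_eq_one, h, hM, if_neg hij']
    split_ifs <;> simp
  have hadj : ∀ u v, (decompositionDiagram ts).graph.Adj u v ↔
      (coxeterDiagram (CoxeterMatrix.A N)).graph.Adj (finCongr hl u) (finCongr hl v) := by
    intro u v
    simp only [decompositionDiagram, coxeterDiagram, SimpleGraph.fromRel_adj,
      (finCongr hl).injective.ne_iff]
    refine and_congr_right fun huv => ?_
    rw [hcomm u v huv, hcomm v u huv.symm]
  refine ⟨finCongr hl, hadj, fun u v huv => ?_⟩
  have h3 : CoxeterMatrix.A N (finCongr hl u) (finCongr hl v) = 3 := by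
    have h2 := (hadj u v).1 huv
    simp only [coxeterDiagram, SimpleGraph.fromRel_adj,
      CoxeterMatrix.symmetric _ (finCongr hl v), or_self] at h2
    obtain ⟨h4, h5⟩ := h2
    rw [hM, if_neg h4] at h5 ⊢
    split_ifs at h5 ⊢ with h6
    · rfl
    · exact absurd rfl h5
  simp only [decompositionDiagram, coxeterDiagram, h, h3]
  simp

end Diagram

/-! ### Coxeter elements and parabolicity of the signed symmetric group -/

section Parabolic

variable {N : ℕ}

theorem swap_castSucc_succ_injective :
    Function.Injective fun i : Fin N => Equiv.swap i.castSucc i.succ := by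
  intro i j hij
  by_contra h
  have h1 := orderOf_swap_mul_swap (N := N) Function.injective_id i j
  have h2 : Equiv.swap i.castSucc i.succ = Equiv.swap j.castSucc j.succ := hij
  simp only [id, h2, Equiv.swap_mul_self, orderOf_one] at h1
  exact CoxeterMatrix.off_diagonal _ i j h h1.symm

theorem prod_ofFn_swap : (List.ofFn fun i : Fin N => Equiv.swap i.castSucc i.succ).prod =
    (List.finRange (N + 1)).formPerm := by
  rw [List.formPerm]
  congr 1
  apply List.ext_getElem
  · simp
  · intro i h1 h2
    simp

theorem isConj_formPerm {α : Type*} [DecidableEq α] [Fintype α] {l l' : List α} (h : l.Nodup)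
    (h' : l'.Nodup) (hl : 2 ≤ l.length) (hll : l.length = l'.length) :
    IsConj l.formPerm l'.formPerm := by
  refine (List.isCycle_formPerm h hl).isConj (List.isCycle_formPerm h' (hll ▸ hl)) ?_
  rw [List.support_formPerm_of_nodup _ h, List.support_formPerm_of_nodup _ h',
    List.toFinset_card_of_nodup h, List.toFinset_card_of_nodup h', hll]
  · rintro a rfl
    simp at hll hl
    omega
  · rintro a rfl
    simp at hl

/-- The images of the transpositions of consecutive points. -/
def signedSimple (d : Fin (N + 1) → ℤˣ) : Set (signedPerm d).range :=
  {s | ∃ i : Fin N, (s : W (N + 1)) = signedPerm d (Equiv.swap i.castSucc i.succ)}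

/-- In the symmetric group the product of the consecutive transpositions is a cycle through all
points, and all such cycles are conjugate; `signedPerm d` transports this. -/
theorem isCoxeterElement_signedSimple (d : Fin (N + 1) → ℤˣ) (hN : 1 ≤ N)
    {y : List (Fin (N + 1))} (hy : y.Nodup) (hl : y.length = N + 1)
    {w : (signedPerm d).range} (hw : (w : W (N + 1)) = signedPerm d y.formPerm) :
    IsCoxeterElement (signedSimple d) w := by
  let e : Equiv.Perm (Fin (N + 1)) ≃* (signedPerm d).range :=
    MonoidHom.ofInjective (signedPerm_injective d)
  have he : ∀ τ, (e τ : W (N + 1)) = signedPerm d τ := fun _ => rfl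
  obtain ⟨cs, hcs⟩ := exists_coxeterSystem_perm N
  have hs : ∀ i, (cs.map e).simple i = e (Equiv.swap i.castSucc i.succ) := fun i => by
    rw [CoxeterSystem.map_simple, hcs]
  have hinj : Function.Injective (cs.map e).simple := fun i j hij => by
    rw [hs, hs] at hij
    exact swap_castSucc_succ_injective (e.injective hij)
  have hS : signedSimple d = Set.range (cs.map e).simple := by
    ext s
    refine exists_congr fun i => ?_
    rw [hs, ← he, Subtype.coe_inj, eq_comm]
  rw [hS]
  refine ⟨.of_coxeterSystem _ hinj, List.ofFn (cs.map e).simple, List.nodup_ofFn.2 hinj,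
    fun g => List.mem_ofFn, ?_⟩
  have hprod : (List.ofFn (cs.map e).simple).prod = e (List.finRange (N + 1)).formPerm := by
    rw [← prod_ofFn_swap, map_list_prod, List.map_ofFn]
    congr 2
    funext i
    exact hs i
  have hw' : w = e y.formPerm := Subtype.ext hw
  rw [hprod, hw']
  exact e.toMonoidHom.map_isConj (isConj_formPerm (List.nodup_finRange _) hy
    (by simpa using hN) (by simp [hl]))

/-- An element of the range is determined by its permutation, so it is a reflection of `W` exactly
when that permutation is a transposition, and all transpositions are conjugate. -/
theorem reflections_signedSimple (d : Fin (N + 1) → ℤˣ) (hN : 1 ≤ N) (t : (signedPerm d).range) :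
    t ∈ reflections (signedSimple d) ↔ (t : W (N + 1)) ∈ T (N + 1) := by
  have hne : ∀ i : Fin N, i.castSucc ≠ i.succ := fun i h => by
    simp [Fin.ext_iff] at h
  obtain ⟨_, τ, rfl⟩ := t
  constructor
  · rintro ⟨⟨_, s, rfl⟩, ⟨i, hi⟩, ⟨_, g, rfl⟩, h⟩
    obtain rfl := signedPerm_injective d hi
    have h1 := congrArg Subtype.val h
    simp only [Subgroup.coe_mul, Subgroup.coe_inv, ← map_mul, ← map_inv] at h1
    obtain rfl := signedPerm_injective d h1
    rw [mem_T_iff, ← Equiv.swap_apply_apply]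
    exact ⟨_, _, _, g.injective.ne (hne i), signedPerm_swap _ _ _ (g.injective.ne (hne i))⟩
  · intro h
    obtain ⟨i, j, s, hij, h⟩ := mem_T_iff.1 h
    have h1 : τ = Equiv.swap i j := by
      have h2 := congrArg Subtype.val h
      rw [coe_signedPerm, coe_refl] at h2
      rw [← inv_inv τ, (monomial_injective h2).1, Equiv.swap_inv]
    obtain ⟨c, hc⟩ := isConj_iff.1 (Equiv.Perm.isConj_swap (hne ⟨0, hN⟩) hij)
    refine ⟨⟨_, _, rfl⟩, ⟨⟨0, hN⟩, rfl⟩, ⟨_, c, rfl⟩, Subtype.ext ?_⟩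
    simp only [Subgroup.coe_mul, Subgroup.coe_inv, ← map_mul, ← map_inv]
    rw [hc, h1]

theorem exists_conjSet_eq (d : Fin (N + 1) → ℤˣ) : ∃ I ⊆ simpleGenerators (N + 1), ∃ g,
    conjSet g I = Subtype.val '' signedSimple d := by
  have hne : ∀ i : Fin N, i.castSucc ≠ i.succ := fun i h => by
    simp [Fin.ext_iff] at h
  set c := ∏ i, d i
  have hcc : c * c = 1 := Int.units_mul_self c
  -- When `c = -1`, `diag(d)` is not in `W`. Changing its sign at index `0` repairs this, and only
  -- the generator involving `0` is affected: `(1, 2)` is replaced by its overlined version.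
  refine ⟨Set.range fun i : Fin N => refl i.castSucc i.succ (if i.castSucc = 0 then c else 1), ?_,
    ⟨monomial 1 fun i => d i * if i = 0 then c else 1, _, _, ?_, rfl⟩, ?_⟩
  · rintro _ ⟨i, rfl⟩
    by_cases hi : i.castSucc = 0
    · rcases Int.units_eq_one_or c with h | h
      · exact Or.inl ⟨i.castSucc, i.succ, by simp, by simp [h]⟩
      · have hi' : (i : ℕ) = 0 := by simpa [Fin.ext_iff] using hi
        exact Or.inr ⟨i.castSucc, i.succ, by simpa using hi', by simpa using hi', by simp [h, hi]⟩
    · exact Or.inl ⟨i.castSucc, i.succ, by simp, by simp [hi]⟩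
  · rw [Finset.prod_mul_distrib, Finset.prod_ite_eq' Finset.univ 0, if_pos (Finset.mem_univ _)]
    exact hcc
  · have key : ∀ (g : W (N + 1)), (g : (Matrix (Fin (N + 1)) (Fin (N + 1)) ℤ)ˣ) =
        (monomial 1 fun i => d i * if i = 0 then c else 1) → ∀ i : Fin N,
        g * refl i.castSucc i.succ (if i.castSucc = 0 then c else 1) * g⁻¹ =
          signedPerm d (Equiv.swap i.castSucc i.succ) := by
      intro g hg i
      refine (conj_refl (σ := 1) (by rw [hg, inv_one]) (hne i) _).trans ?_
      rw [signedPerm_swap _ _ _ (hne i)]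
      show refl i.castSucc i.succ (d i.castSucc * (if i.castSucc = 0 then c else 1) *
        (d i.succ * if i.succ = 0 then c else 1) * if i.castSucc = 0 then c else 1) = _
      rw [if_neg (Fin.succ_ne_zero i), mul_one, mul_right_comm, mul_assoc (d i.castSucc)]
      by_cases hi : i.castSucc = 0
      · rw [if_pos hi, hcc, mul_one]
      · rw [if_neg hi, mul_one, mul_one]
    ext t
    constructor
    · rintro ⟨_, ⟨i, rfl⟩, rfl⟩
      rw [key _ rfl i]
      exact ⟨⟨_, _, rfl⟩, ⟨i, rfl⟩, rfl⟩
    · rintro ⟨s, ⟨i, hi⟩, rfl⟩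
      exact ⟨_, ⟨i, rfl⟩, by rw [hi]; exact (key _ rfl i).symm⟩

theorem closure_signedSimple (d : Fin (N + 1) → ℤˣ) :
    Subgroup.closure (Subtype.val '' signedSimple d) = (signedPerm d).range := by
  obtain ⟨cs, hcs⟩ := exists_coxeterSystem_perm N
  have h : (signedPerm d).range = Subgroup.closure (signedPerm d '' Set.range cs.simple) := by
    rw [MonoidHom.range_eq_map, ← cs.subgroup_closure_range_simple, MonoidHom.map_closure]
  refine Eq.trans (congrArg _ ?_) h.symm
  ext t
  constructor
  · rintro ⟨s, ⟨i, hi⟩, rfl⟩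
    exact ⟨_, ⟨i, hcs i⟩, hi.symm⟩
  · rintro ⟨_, ⟨i, rfl⟩, rfl⟩
    exact ⟨⟨_, _, rfl⟩, ⟨i, by rw [hcs]⟩, rfl⟩

theorem isParabolicCoxeterElement_of_isCoxeterElement {G : Type*} [Group G] {S I : Set G} {g : G}
    (hI : I ⊆ S) {P : Subgroup G} {S' : Set P} (hS : conjSet g I = Subtype.val '' S')
    (hP : Subgroup.closure (conjSet g I) = P) {w : P} (hw : IsCoxeterElement S' w) :
    IsParabolicCoxeterElement S (w : G) := by
  subst hP
  refine ⟨I, hI, g, w, rfl, ?_⟩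
  convert hw using 1
  ext s
  constructor
  · intro hs
    obtain ⟨s', hs', h⟩ := hS.subset hs
    rwa [← Subtype.ext h]
  · intro hs
    exact hS.superset ⟨s, hs, rfl⟩

end Parabolic

/-! ### Reduced decompositions and the product of the procedure -/

variable {n : ℕ}

theorem isCycleOn_formPerm_univ {y : List (Fin n)} (hy : y.Nodup) (hl : y.length = n) :
    y.formPerm.IsCycleOn Set.univ := by
  have h := hy.isCycleOn_formPerm
  rwa [show {a | a ∈ y} = Set.univ from
    Set.eq_univ_of_forall fun i => mem_of_nodup_of_length hy hl i] at h

/-- The exhibited decomposition `ts` meets the lower bound of `decomposition_of_isCycleOn`, so the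
reflection length is exactly `n - 1`. -/
theorem isReducedDecomposition_iff {w : W n} {ρ : Equiv.Perm (Fin n)} {ε : Fin n → ℤˣ}
    (hn : 0 < n) (hw : (w : (Matrix (Fin n) (Fin n) ℤ)ˣ) = monomial ρ ε)
    (hρ : ρ.IsCycleOn Set.univ) {ts : List (W n)} (hts : ∀ t ∈ ts, t ∈ T n) (hprod : ts.prod = w)
    (hl : ts.length = n - 1) {us : List (W n)} :
    IsReducedDecomposition (T n) us w ↔
      (∀ t ∈ us, t ∈ T n) ∧ us.prod = w ∧ us.length = n - 1 := by
  have h : lengthOver (T n) w = n - 1 := by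
    apply le_antisymm
    · exact Nat.sInf_le ⟨ts, hts, hprod, hl⟩
    · refine le_csInf ⟨_, ts, hts, hprod, hl⟩ ?_
      rintro _ ⟨vs, hvs, hvprod, rfl⟩
      exact (decomposition_of_isCycleOn hn hw hρ hvs hvprod).1
  rw [IsReducedDecomposition, h]

theorem decompositionDiagram_procedureReflections {N : ℕ} {x : List (Fin (N + 1) × ℤˣ)}
    (hl : x.length = N + 1) (hx : (x.map Prod.fst).Nodup) {d : Fin (N + 1) → ℤˣ}
    (hd : x.IsChain fun u v => d u.1 * d v.1 = u.2) :
    (decompositionDiagram (procedureReflections x).reverse).IsIsomorphic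
      (coxeterDiagram (CoxeterMatrix.A N)) := by
  have hlen : (procedureReflections x).reverse.length = N := by
    rw [List.length_reverse, length_procedureReflections, hl]
    rfl
  refine decompositionDiagram_isIsomorphic hlen fun i j => ?_
  set y := x.map Prod.fst
  have hy : y.length = N + 1 := by simpa [y] using hl
  -- The factors are listed in reverse, so the letters are read backwards to make them
  -- transpositions of consecutive values of `p`.
  let p : Fin (N + 1) → Fin (N + 1) := fun k => y[N - k]
  have hp : Function.Injective p := fun a b hab => by
    have := (hx.getElem_inj_iff).1 hab
    apply Fin.ext
    omega
  have hget : ∀ i : Fin (procedureReflections x).reverse.length,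
      (procedureReflections x).reverse.get i = signedPerm d
        (Equiv.swap (p (finCongr hlen i).castSucc) (p (finCongr hlen i).succ)) := by
    intro i
    have hi : (i : ℕ) < N := lt_of_lt_of_eq i.2 hlen
    have h1 : N - 1 - i < (procedureReflections x).length := by
      rw [length_procedureReflections, hl]
      omega
    have h2 : (procedureReflections x).reverse.get i = (procedureReflections x)[N - 1 - i] := by
      rw [List.get_eq_getElem, List.getElem_reverse]
      refine getElem_congr_idx ?_
      rw [length_procedureReflections, hl]
      rfl
    have h3 : p (finCongr hlen i).castSucc = y[N - 1 - i + 1] :=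
      getElem_congr_idx (show N - i = N - 1 - i + 1 by omega)
    have h4 : p (finCongr hlen i).succ = y[N - 1 - i] :=
      getElem_congr_idx (show N - (i + 1) = N - 1 - i by omega)
    rw [h2, h3, h4, Equiv.swap_comm]
    simp only [procedureReflections_eq_map hx hd, List.getElem_map, List.getElem_zipWith,
      List.getElem_tail, y]
  rw [hget, hget, ← map_mul, orderOf_injective _ (signedPerm_injective d),
    orderOf_swap_mul_swap hp]

/-- The factors are involutions, so reversing the list inverts the product; the forward product is
the image of `List.formPerm` by its definition. -/
theorem prod_reverse_procedureReflections {x : List (Fin n × ℤˣ)} (hx : (x.map Prod.fst).Nodup)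
    {d : Fin n → ℤˣ} (hd : x.IsChain fun u v => d u.1 * d v.1 = u.2) :
    (procedureReflections x).reverse.prod = signedPerm d (x.map Prod.fst).formPerm⁻¹ := by
  have hT : ∀ t ∈ procedureReflections x, t⁻¹ = t := by
    rw [procedureReflections_eq_map hx hd]
    rintro _ ht
    obtain ⟨τ, hτ, rfl⟩ := List.mem_map.1 ht
    obtain ⟨a, b, rfl⟩ : ∃ a b, Equiv.swap a b = τ := by
      obtain ⟨k, hk, rfl⟩ := List.getElem_of_mem hτ
      exact ⟨_, _, List.getElem_zipWith.symm⟩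
    rw [← map_inv, Equiv.swap_inv]
  rw [map_inv, ← inv_inj, inv_inv, List.prod_inv_reverse, List.map_reverse, List.reverse_reverse,
    List.map_congr_left hT, List.map_id', procedureReflections_eq_map hx hd, ← map_list_prod]
  rfl

theorem mem_T_of_mem_procedureReflections {x : List (Fin n × ℤˣ)} (hx : (x.map Prod.fst).Nodup)
    {t : W n} (ht : t ∈ procedureReflections x) : t ∈ T n := by
  induction x with
  | nil => simp [procedureReflections] at ht
  | cons u x ih =>
    cases x with
    | nil => simp [procedureReflections] at ht
    | cons v l =>
      rcases List.mem_cons.1 ht with rfl | ht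
      · exact mem_T_iff.2 ⟨_, _, _, fun h => by simp [h] at hx, rfl⟩
      · exact ih (List.nodup_cons.1 hx).2 ht

end TypeD

theorem mainTheorem5 (n m : ℕ) (hn : 4 ≤ n) (hm : 1 ≤ m) (hmn : m ≤ n / 2)
    (w₀ : TypeD.W n) (hw₀ : TypeD.IsTypeI m w₀) :
    (∃ x : List (Fin n × ℤˣ), TypeD.IsFullMarkedCycle x w₀ ∧
      Even (x.countP fun y => y.2 = -1)) ∧
    ∀ x : List (Fin n × ℤˣ), TypeD.IsFullMarkedCycle x w₀ →
      ∀ ts : List (TypeD.W n), ts = (TypeD.procedureReflections x).reverse →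
      ∀ P : Subgroup (TypeD.W n), P = Subgroup.closure {t | t ∈ ts} →
        TypeD.IsReducedDecomposition (TypeD.T n) ts w₀ ∧
        (TypeD.decompositionDiagram ts).IsIsomorphic
          (TypeD.coxeterDiagram (CoxeterMatrix.A (n - 1))) ∧
        (∀ us : List (TypeD.W n), TypeD.IsReducedDecomposition (TypeD.T n) us w₀ →
          Subgroup.closure {t | t ∈ us} = P) ∧
        TypeD.IsCoxeterElementIn (TypeD.T n) P w₀ ∧
        TypeD.IsParabolicSubgroup (TypeD.simpleGenerators n) P ∧
        TypeD.IsParabolicCoxeterElement (TypeD.simpleGenerators n) w₀ := by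
  refine ⟨hw₀.exists_isFullMarkedCycle, ?_⟩
  rintro x hx ts hts P rfl
  obtain ⟨N, rfl⟩ : ∃ N, n = N + 1 := ⟨n - 1, by omega⟩
  obtain ⟨d, hd, hwd⟩ := hx.exists_signedPerm (Nat.succ_pos N)
  obtain ⟨hl, hnd, hw⟩ := hx
  set y := x.map Prod.fst with hy
  have hyl : y.length = N + 1 := by simpa [y] using hl
  have hcyc := isCycleOn_formPerm_univ hnd hyl
  have htsT : ∀ t ∈ ts, t ∈ TypeD.T (N + 1) := fun t ht => by
    subst hts
    exact mem_T_of_mem_procedureReflections hnd (List.mem_reverse.1 ht)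
  have hprod : ts.prod = w₀ := by
    rw [hts, hwd, prod_reverse_procedureReflections hnd hd]
  have htsl : ts.length = N + 1 - 1 := by
    rw [hts, List.length_reverse, length_procedureReflections, hl]
  have hiff := fun us => isReducedDecomposition_iff (Nat.succ_pos N) hw hcyc htsT hprod htsl
    (us := us)
  have hmem : w₀ ∈ (signedPerm d).range := ⟨_, hwd.symm⟩
  have hclosure : ∀ us : List (TypeD.W (N + 1)),
      TypeD.IsReducedDecomposition (TypeD.T (N + 1)) us w₀ →
      Subgroup.closure {t | t ∈ us} = (signedPerm d).range := by
    intro us hus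
    obtain ⟨h1, h2, h3⟩ := (hiff us).1 hus
    obtain ⟨d', hd'⟩ := (decomposition_of_isCycleOn (Nat.succ_pos N) hw hcyc h1 h2).2 h3
    have h4 : w₀ ∈ (signedPerm d').range := by
      rw [← hd', ← h2]
      exact Subgroup.list_prod_mem _ fun u hu => Subgroup.subset_closure hu
    rw [hd', signedPerm_eq_of_mem_range hw hcyc h4 hmem]
  have hred := (hiff ts).2 ⟨htsT, hprod, htsl⟩
  -- The word `y` is reversed because `w₀` is the image of the inverse cycle.
  have hcox : TypeD.IsCoxeterElement (signedSimple d) ⟨w₀, hmem⟩ :=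
    isCoxeterElement_signedSimple d (by omega) (List.nodup_reverse.2 hnd) (by simpa using hyl)
      (by rw [List.formPerm_reverse]; exact hwd)
  obtain ⟨I, hI, g, hg⟩ := exists_conjSet_eq d
  have hP := closure_signedSimple d
  rw [← hg] at hP
  refine ⟨hred, ?_, fun us hus => ?_, ?_, ?_, ?_⟩
  · rw [hts]
    exact decompositionDiagram_procedureReflections hl hnd hd
  · rw [hclosure us hus, hclosure ts hred]
  · rw [hclosure ts hred]
    exact ⟨_, _, rfl, reflections_signedSimple d (by omega), hcox⟩
  · rw [hclosure ts hred]
    exact ⟨I, hI, g, hP.symm⟩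
  · exact isParabolicCoxeterElement_of_isCoxeterElement hI hg hP hcox
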